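/- Let $0<\mu<\lambda$, and let $\{U_n\}_{n\ge1}$ and $\{D_n\}_{n\ge1}$ be independent sequences of i.i.d. random variables, $U_n$ exponential with rate $\lambda$ and $D_n$ exponential with rate $\mu$. Put $N(t)=\max\{n\ge 0:\sum_{i=1}^n U_i\le t\}$, $Y(t)=\sum_{n=1}^{N(t)}D_n$ and $T_0=\inf\{t>0: Y(t)\ge t\}$ (with $\inf\emptyset=\infty$). Then $T_0$ has the probability density function $$\psi_0(t)=\frac{\lambda e^{-(\lambda+\mu)t}}{t\sqrt{\lambda\mu}}\,I_1\!\left(2t\sqrt{\lambda\mu}\right),\qquad t\in(0,\infty),$$ where $I_1(z)=\frac z2\sum_{k=0}^\infty \frac{(z^2/4)^k}{k!\,(k+1)!}$ is the modified Bessel function of the first kind of order $1$. That is, the law of $T_0$ is $\psi_0(t)\,dt$ on $(0,\infty)$ (in particular $T_0<\infty$ almost surely), and $\frac{d}{dt}\mathbb P(T_0\le t)=\psi_0(t)$ for every $t>0$. Moreover, $\psi_0$ is, in the same sense, the probability density function of the length of a busy period of an M/M/1 queue with arrival rate $\mu$ and service rate $\lambda$. -/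

import Mathlib

open MeasureTheory ProbabilityTheory Set
open scoped ENNReal Nat

namespace Telegraph

/-- The modified Bessel function of the first kind of order `n`,
`I_n(z) = (z/2)^n ∑_k (z²/4)^k / (k! (k+n)!)`. -/
noncomputable def besselI (n : ℕ) (z : ℝ) : ℝ :=
  (z / 2) ^ n * ∑' k : ℕ, (z ^ 2 / 4) ^ k / ((k ! : ℝ) * ((k + n)! : ℝ))

/-- The density `λ e^{-(λ+μ)t} I₁(2t√(λμ)) / (t√(λμ))`, with `l` for `λ` and `m` for `μ`. -/
noncomputable def psiZero (l m t : ℝ) : ℝ :=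
  l * Real.exp (-(l + m) * t) / (t * Real.sqrt (l * m)) *
    besselI 1 (2 * t * Real.sqrt (l * m))

section Model

variable {Ω : Type*}

/-- The counting process `N(t) = max {n : U_1 + ⋯ + U_n ≤ t}`. Sequences are indexed from `0`,
so that `U n` stands for `U_{n+1}`. (If the set is unbounded, which for i.i.d. exponential `U`
has probability zero, the value is the default `0`.) -/
noncomputable def countN (U : ℕ → Ω → ℝ) (t : ℝ) (ω : Ω) : ℕ :=
  sSup {n : ℕ | ∑ i ∈ Finset.range n, U i ω ≤ t}

/-- The compound process `Y(t) = D_1 + ⋯ + D_{N(t)}`. -/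
noncomputable def compoundY (U D : ℕ → Ω → ℝ) (t : ℝ) (ω : Ω) : ℝ :=
  ∑ n ∈ Finset.range (countN U t ω), D n ω

/-- The first-passage time `T_x = inf {t > 0 : Y(t) ≥ x + t}`, equal to `∞` if the set is empty. -/
noncomputable def passageTime (U D : ℕ → Ω → ℝ) (x : ℝ) (ω : Ω) : ℝ≥0∞ :=
  sInf (ENNReal.ofReal '' {t : ℝ | 0 < t ∧ x + t ≤ compoundY U D t ω})

/-- Arrival time of customer `n` at a queue: customer `0` arrives at time `0`, and `A n` is the
time between the arrivals of customers `n` and `n + 1`. -/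
noncomputable def arrivalTime (A : ℕ → Ω → ℝ) (n : ℕ) (ω : Ω) : ℝ :=
  ∑ i ∈ Finset.range n, A i ω

/-- Departure time of customer `n` from the single-server first-come-first-served queue with
service times `S` and interarrival times `A`, where customer `0` finds the system empty: service
of a customer starts upon arrival or when the previous customer leaves, whichever is later. -/
noncomputable def departureTime (S A : ℕ → Ω → ℝ) : ℕ → Ω → ℝ
  | 0, ω => arrivalTime A 0 ω + S 0 ω
  | n + 1, ω => max (arrivalTime A (n + 1) ω) (departureTime S A n ω) + S (n + 1) ω

/-- Number of customers in the system at time `t`. -/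
noncomputable def numberInSystem (S A : ℕ → Ω → ℝ) (t : ℝ) (ω : Ω) : ℕ∞ :=
  {n : ℕ | arrivalTime A n ω ≤ t ∧ t < departureTime S A n ω}.encard

/-- Length of the busy period that customer `0` opens at time `0`: the first `t > 0` at which the
system is empty (`∞` if there is none). -/
noncomputable def busyPeriod (S A : ℕ → Ω → ℝ) (ω : Ω) : ℝ≥0∞ :=
  sInf (ENNReal.ofReal '' {t : ℝ | 0 < t ∧ numberInSystem S A t ω = 0})

/-- `T`, a random time with values in `[0, ∞]`, has the probability density function `f` on
`(0, ∞)`: `T` is a random variable whose law is `f(t) dt` on `(0, ∞)` (for a probability measure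
`P` this includes that `T` is almost surely finite and that `f` has total mass one), and moreover
`f(t) = d/dt P(T ≤ t)` at every `t > 0`. -/
structure HasDensity [MeasurableSpace Ω] (P : Measure Ω) (T : Ω → ℝ≥0∞) (f : ℝ → ℝ) : Prop where
  nonneg : ∀ t, 0 < t → 0 ≤ f t
  law : HasLaw T (((volume.restrict (Ioi (0 : ℝ))).withDensity
    (fun t => ENNReal.ofReal (f t))).map ENNReal.ofReal) P
  deriv : ∀ t, 0 < t →
    HasDerivAt (fun s : ℝ => P.real {ω | T ω ≤ ENNReal.ofReal s}) (f t) t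

end Model

end Telegraph

/-! Between renewal epochs `Y(t)` is constant while `t` grows, so `Y(t) ≥ t` can first occur only at
a jump: `T_0` equals `U_1 + ⋯ + U_n` for the first `n` at which the sum of the `D`s reaches that of
the `U`s. If the `U`s are service times and the `D`s interarrival times, the server works without a
break until this same index, so the busy period has the same length almost surely.

A product of exponential densities depends only on the endpoint of the path. Hence the density of
the two sums, on the event that no earlier catching up has occurred, is an exponential times the
volume of a region of dominated increasing sequences, the polynomial `ballotPoly`; this is an
induction by convolution (`walkDensity_lconvolution`, `map_walk_restrict_staysBelow`). Integrating
out the overshoot evaluates the polynomial on the diagonal, where it is `t ^ (2k) / (k! (k+1)!)`,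
and the sum over `k` is the Bessel series. Total mass one needs no computation: by the strong law
and `1/λ < 1/μ`, catching up is almost sure. -/

namespace Telegraph

/-! ### Volumes of dominated pairs of increasing sequences -/

/-- For `b ≤ a`, the volume of the set of pairs of increasing sequences in `[0, a]` and `[0, b]` of
length `k` such that every entry of the second lies below the same entry of the first. -/
noncomputable def ballotPoly (k : ℕ) (a b : ℝ) : ℝ :=
  a ^ k * b ^ k / ((k ! : ℝ) * (k ! : ℝ)) - k * a ^ (k - 1) * b ^ (k + 1) / ((k ! : ℝ) * ((k + 1)! : ℝ))

/-- The antiderivative of `ballotPoly k · b` that vanishes at `b`. -/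
noncomputable def ballotPolyInt (k : ℕ) (a b : ℝ) : ℝ :=
  a ^ (k + 1) * b ^ k / (((k + 1)! : ℝ) * (k ! : ℝ)) - a ^ k * b ^ (k + 1) / ((k ! : ℝ) * ((k + 1)! : ℝ))

lemma ballotPoly_nonneg (k : ℕ) {a b : ℝ} (hb : 0 ≤ b) (hab : b ≤ a) : 0 ≤ ballotPoly k a b := by
  have ha : 0 ≤ a := hb.trans hab
  unfold ballotPoly
  rcases k with _ | k
  · simp
  · have h1 : ((k + 1 + 1)! : ℝ) = (k + 2) * ((k + 1)! : ℝ) := by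
      rw [Nat.factorial_succ (k + 1)]; push_cast; ring
    have h2 : (0 : ℝ) < ((k + 1)! : ℝ) := by positivity
    have : a ^ (k + 1) * b ^ (k + 1) / (((k + 1)! : ℝ) * ((k + 1)! : ℝ)) -
        ((k + 1 : ℕ) : ℝ) * a ^ (k + 1 - 1) * b ^ (k + 1 + 1) / (((k + 1)! : ℝ) * ((k + 1 + 1)! : ℝ)) =
        a ^ k * b ^ (k + 1) / (((k + 1)! : ℝ) * ((k + 1)! : ℝ)) * (((k + 1) * (a - b) + a) / (k + 2)) := by
      rw [h1]; push_cast; field_simp; ring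
    rw [this]
    have : 0 ≤ a - b := sub_nonneg.2 hab
    positivity

lemma ballotPolyInt_nonneg (k : ℕ) {a b : ℝ} (hb : 0 ≤ b) (hab : b ≤ a) :
    0 ≤ ballotPolyInt k a b := by
  have ha : 0 ≤ a := hb.trans hab
  have : ballotPolyInt k a b = a ^ k * b ^ k * (a - b) / ((k ! : ℝ) * ((k + 1)! : ℝ)) := by
    unfold ballotPolyInt; field_simp; ring
  rw [this]
  have : 0 ≤ a - b := sub_nonneg.2 hab
  positivity

lemma ballotPolyInt_self (k : ℕ) (b : ℝ) : ballotPolyInt k b b = 0 := by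
  unfold ballotPolyInt; field_simp; ring

lemma hasDerivAt_ballotPolyInt (k : ℕ) (a b : ℝ) :
    HasDerivAt (fun x => ballotPolyInt k x b) (ballotPoly k a b) a := by
  have h1 := (((hasDerivAt_pow (k + 1) a).mul_const (b ^ k)).div_const
    (((k + 1)! : ℝ) * (k ! : ℝ))).sub
    (((hasDerivAt_pow k a).mul_const (b ^ (k + 1))).div_const ((k ! : ℝ) * ((k + 1)! : ℝ)))
  refine h1.congr_deriv ?_
  unfold ballotPoly
  rw [Nat.factorial_succ k]; push_cast; field_simp

/-- Fix the largest entry `b` of the second sequence: the largest entry of the first then ranges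
over `(b, a)`, and the remaining `k` pairs have volume `ballotPoly k`. -/
lemma hasDerivAt_ballotPoly_succ (k : ℕ) (a b : ℝ) :
    HasDerivAt (fun x => ballotPoly (k + 1) a x) (ballotPolyInt k a b) b := by
  have h1 := (((hasDerivAt_pow (k + 1) b).const_mul (a ^ (k + 1))).div_const
    (((k + 1)! : ℝ) * ((k + 1)! : ℝ))).sub
    (((hasDerivAt_pow (k + 1 + 1) b).const_mul (((k + 1 : ℕ) : ℝ) * a ^ (k + 1 - 1))).div_const
      (((k + 1)! : ℝ) * ((k + 1 + 1)! : ℝ)))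
  refine h1.congr_deriv ?_
  unfold ballotPolyInt
  rw [Nat.factorial_succ (k + 1), Nat.factorial_succ k]; push_cast
  field_simp

lemma ballotPoly_succ_zero (k : ℕ) (a : ℝ) : ballotPoly (k + 1) a 0 = 0 := by
  simp [ballotPoly]

/-- On the diagonal this is the Catalan number `C_k` times `a ^ (2k) / (2k)!`: among the orderings
of `2k` points, the ballot sequences are counted. -/
lemma ballotPoly_diag (k : ℕ) (a : ℝ) :
    ballotPoly k a a = a ^ (2 * k) / ((k ! : ℝ) * ((k + 1)! : ℝ)) := by
  unfold ballotPoly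
  rcases k with _ | k
  · simp
  · rw [Nat.factorial_succ (k + 1)]; push_cast; field_simp; ring

/-- The Newton–Leibniz formula for the Lebesgue integral of a nonnegative continuous function. -/
lemma lintegral_Ioo_ofReal_deriv {F f : ℝ → ℝ} {a b : ℝ} (hab : a ≤ b)
    (hF : ∀ x, HasDerivAt F (f x) x) (hf : Continuous f) (h0 : ∀ x ∈ Ioo a b, 0 ≤ f x) :
    ∫⁻ x in Ioo a b, ENNReal.ofReal (f x) = ENNReal.ofReal (F b - F a) := by
  rw [← intervalIntegral.integral_eq_sub_of_hasDerivAt (fun x _ => hF x)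
    (hf.intervalIntegrable a b), intervalIntegral.integral_of_le hab, integral_Ioc_eq_integral_Ioo,
    ofReal_integral_eq_lintegral_ofReal]
  · exact (hf.integrableOn_Icc).mono_set Ioo_subset_Icc_self
  · exact (ae_restrict_iff' measurableSet_Ioo).2 (ae_of_all _ h0)

/-- Recursion on the top entries `b < a`; `C` will carry the exponential factor, which does not vary
in the integration. -/
lemma lintegral_lintegral_ballotPoly (k : ℕ) {A M C : ℝ} (hC : 0 ≤ C) (hM : 0 ≤ M) (hMA : M ≤ A) :
    ∫⁻ b in Ioo 0 M, ∫⁻ a in Ioo b A, ENNReal.ofReal (C * ballotPoly k a b) =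
      ENNReal.ofReal (C * ballotPoly (k + 1) A M) := by
  have h1 : ∀ b ∈ Ioo 0 M, ∫⁻ a in Ioo b A, ENNReal.ofReal (C * ballotPoly k a b) =
      ENNReal.ofReal (C * ballotPolyInt k A b) := by
    intro b hb
    rw [lintegral_Ioo_ofReal_deriv (hb.2.le.trans hMA)
      (fun x => (hasDerivAt_ballotPolyInt k x b).const_mul C)
      (by unfold ballotPoly; fun_prop)
      (fun x hx => mul_nonneg hC (ballotPoly_nonneg k hb.1.le hx.1.le)), ballotPolyInt_self]
    simp
  rw [setLIntegral_congr_fun measurableSet_Ioo h1, lintegral_Ioo_ofReal_deriv hM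
      (fun x => (hasDerivAt_ballotPoly_succ k A x).const_mul C)
      (by unfold ballotPolyInt; fun_prop)
      (fun x hx => mul_nonneg hC (ballotPolyInt_nonneg k hx.1.le (hx.2.le.trans hMA))),
      ballotPoly_succ_zero]
  simp

/-! ### Joint density of the sums before catching up -/

/-- The density of the `k + 1`-st partial sums `(∑ U, ∑ D)` on the event that the sums of `D` have
stayed below those of `U` until then. -/
noncomputable def walkDensity (l m : ℝ) (k : ℕ) (x : ℝ × ℝ) : ℝ≥0∞ :=
  {x : ℝ × ℝ | 0 < x.1 ∧ 0 < x.2}.indicator (fun x => ENNReal.ofReal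
    ((l * m) ^ (k + 1) * Real.exp (-(l * x.1 + m * x.2)) * ballotPoly k x.1 (min x.1 x.2))) x

lemma measurable_walkDensity (l m : ℝ) (k : ℕ) : Measurable (walkDensity l m k) := by
  unfold walkDensity
  refine Measurable.indicator ?_ ?_
  · unfold ballotPoly
    fun_prop
  · exact (measurableSet_lt measurable_const measurable_fst).inter
      (measurableSet_lt measurable_const measurable_snd)

/-- The two exponentials multiply to one in the endpoint `(A, B)` alone, so only the ballot
polynomial is integrated over the previous position `(a, b)`. There `b < a < A` and `b < B`, which
is why `min A B` appears. -/
lemma walkDensity_lconvolution {l m : ℝ} (hl : 0 < l) (hm : 0 < m) (k : ℕ) :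
    lconvolution ({x : ℝ × ℝ | x.2 < x.1}.indicator (walkDensity l m k)) (walkDensity l m 0) volume =
      walkDensity l m (k + 1) := by
  ext ⟨A, B⟩
  rw [lconvolution_def]
  set C : ℝ := (l * m) ^ (k + 1 + 1) * Real.exp (-(l * A + m * B)) with hC
  have hC0 : 0 ≤ C := by positivity
  have key : ∀ y : ℝ × ℝ, {x : ℝ × ℝ | x.2 < x.1}.indicator (walkDensity l m k) y *
      walkDensity l m 0 (-y + (A, B)) =
      (Ioo 0 (min A B)).indicator (fun b => (Ioo b A).indicator
        (fun a => ENNReal.ofReal (C * ballotPoly k a b)) y.1) y.2 := by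
    rintro ⟨a, b⟩
    by_cases h : 0 < b ∧ b < a ∧ a < A ∧ b < B
    · obtain ⟨h1, h2, h3, h4⟩ := h
      have e1 : b ∈ Ioo 0 (min A B) := ⟨h1, lt_min (h2.trans h3) h4⟩
      have e2 : a ∈ Ioo b A := ⟨h2, h3⟩
      have e3 : (a, b) ∈ {x : ℝ × ℝ | x.2 < x.1} := h2
      have e4 : (a, b) ∈ {x : ℝ × ℝ | 0 < x.1 ∧ 0 < x.2} := ⟨h1.trans h2, h1⟩
      have e5 : -(a, b) + (A, B) ∈ {x : ℝ × ℝ | 0 < x.1 ∧ 0 < x.2} := by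
        constructor <;> simp <;> linarith
      rw [indicator_of_mem e1, indicator_of_mem e2, indicator_of_mem e3, walkDensity, walkDensity,
        indicator_of_mem e4, indicator_of_mem e5, ← ENNReal.ofReal_mul' ]
      · congr 1
        simp only [min_eq_right h2.le, Prod.fst_add, Prod.snd_add, Prod.fst_neg, Prod.snd_neg, hC]
        have : Real.exp (-(l * A + m * B)) = Real.exp (-(l * a + m * b)) *
            Real.exp (-(l * (-a + A) + m * (-b + B))) := by
          rw [← Real.exp_add]; ring_nf
        rw [this]
        simp [ballotPoly]
        ring
      · simp [ballotPoly]; positivity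
    · have hr : (Ioo 0 (min A B)).indicator (fun b => (Ioo b A).indicator
        (fun a => ENNReal.ofReal (C * ballotPoly k a b)) a) b = 0 := by
        by_cases e1 : b ∈ Ioo 0 (min A B)
        · rw [indicator_of_mem e1, indicator_of_notMem]
          rintro ⟨h2, h3⟩
          exact h ⟨e1.1, h2, h3, (lt_min_iff.1 e1.2).2⟩
        · exact indicator_of_notMem e1 _
      simp only [hr, mul_eq_zero]
      by_contra! hne
      have e3 := mem_of_indicator_ne_zero hne.1
      rw [indicator_of_mem e3] at hne
      have e4 := mem_of_indicator_ne_zero hne.1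
      have e5 := mem_of_indicator_ne_zero hne.2
      simp at e3 e4 e5
      exact h ⟨e4.2, e3, by linarith, by linarith⟩
  have hmeas : Measurable fun y : ℝ × ℝ =>
      (Ioo 0 (min A B)).indicator (fun b => (Ioo b A).indicator
        (fun a => ENNReal.ofReal (C * ballotPoly k a b)) y.1) y.2 := by
    simp_rw [← key]
    refine Measurable.mul (Measurable.indicator (measurable_walkDensity l m k)
      (measurableSet_lt measurable_snd measurable_fst)) ?_
    exact (measurable_walkDensity l m 0).comp (by fun_prop)
  simp_rw [key]
  rw [Measure.volume_eq_prod, lintegral_prod_symm _ hmeas.aemeasurable]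
  have e : ∀ b : ℝ, ∫⁻ a : ℝ, (Ioo 0 (min A B)).indicator (fun b => (Ioo b A).indicator
        (fun a => ENNReal.ofReal (C * ballotPoly k a b)) a) b =
      (Ioo 0 (min A B)).indicator
        (fun b => ∫⁻ a in Ioo b A, ENNReal.ofReal (C * ballotPoly k a b)) b := by
    intro b
    by_cases e1 : b ∈ Ioo 0 (min A B)
    · simp_rw [indicator_of_mem e1]
      rw [lintegral_indicator measurableSet_Ioo]
    · simp_rw [indicator_of_notMem e1]
      simp
  simp_rw [e]
  rw [lintegral_indicator measurableSet_Ioo]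
  by_cases h : 0 < A ∧ 0 < B
  · rw [lintegral_lintegral_ballotPoly k hC0 (le_min h.1.le h.2.le) (min_le_left _ _), walkDensity,
      indicator_of_mem (by exact h)]
  · rw [Ioo_eq_empty (by simpa [lt_min_iff] using h), walkDensity, indicator_of_notMem (by exact h)]
    simp

lemma expMeasure_prod_expMeasure {l m : ℝ} (hl : 0 < l) :
    (expMeasure l).prod (expMeasure m) = volume.withDensity (walkDensity l m 0) := by
  have h : ∀ r : ℝ, expMeasure r = volume.withDensity (exponentialPDF r) := fun r => rfl
  have hmeas : ∀ r : ℝ, Measurable (exponentialPDF r) := fun r =>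
    (measurable_exponentialPDFReal r).ennreal_ofReal
  rw [h, h, prod_withDensity (hmeas l) (hmeas m), ← Measure.volume_eq_prod]
  refine withDensity_congr_ae ?_
  -- `exponentialPDF` need not vanish at `0`, whereas `walkDensity` lives on the open quadrant; the
  -- axes are null.
  have h1 : ∀ᵐ z : ℝ × ℝ, z.1 ≠ 0 :=
    (Measure.quasiMeasurePreserving_fst (μ := (volume : Measure ℝ)) (ν := (volume : Measure ℝ))).ae
      (Measure.ae_ne volume 0)
  have h2 : ∀ᵐ z : ℝ × ℝ, z.2 ≠ 0 :=
    (Measure.quasiMeasurePreserving_snd (μ := (volume : Measure ℝ)) (ν := (volume : Measure ℝ))).ae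
      (Measure.ae_ne volume 0)
  filter_upwards [h1, h2] with ⟨a, b⟩ ha hb
  simp only at ha hb
  unfold walkDensity
  by_cases h : (a, b) ∈ {x : ℝ × ℝ | 0 < x.1 ∧ 0 < x.2}
  · rw [indicator_of_mem h, exponentialPDF_of_nonneg h.1.le, exponentialPDF_of_nonneg h.2.le,
      ← ENNReal.ofReal_mul (by positivity)]
    congr 1
    simp only [neg_add, Real.exp_add, ballotPoly]
    simp
    ring
  · rw [indicator_of_notMem h]
    simp only [mem_ofPred_eq, not_and_or, not_lt] at h
    rcases h with h | h
    · rw [exponentialPDF_of_neg (lt_of_le_of_ne h ha), zero_mul]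
    · rw [exponentialPDF_of_neg (lt_of_le_of_ne h hb), mul_zero]

/-! ### Density of the passage time as a Bessel series -/

/-- The contribution of passage at the `k + 1`-st jump to the density of the passage time. -/
noncomputable def passageDensity (l m : ℝ) (k : ℕ) (t : ℝ) : ℝ :=
  (l * m) ^ (k + 1) * Real.exp (-(l + m) * t) / m * (t ^ (2 * k) / ((k ! : ℝ) * ((k + 1)! : ℝ)))

lemma lintegral_Ici_exp {m : ℝ} (hm : 0 < m) (a : ℝ) :
    ∫⁻ b in Ici a, ENNReal.ofReal (Real.exp (-(m * b))) =
      ENNReal.ofReal (Real.exp (-(m * a)) / m) := by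
  have hi : IntegrableOn (fun b => Real.exp (-(m * b))) (Ioi a) := by
    simpa only [neg_mul] using exp_neg_integrableOn_Ioi a hm
  rw [setLIntegral_congr Ioi_ae_eq_Ici.symm, ← ofReal_integral_eq_lintegral_ofReal hi
    (ae_of_all _ fun b => (Real.exp_pos _).le)]
  congr 1
  have := integral_exp_mul_Ioi (neg_lt_zero.2 hm) a
  simp only [neg_mul] at this
  rw [this]; field_simp

/-- Where `x.1 ≤ x.2` the minimum is `x.1`, so the second coordinate enters only through `exp (-(m *
x.2))` and integrates out to `exp (-(m * x.1)) / m`. -/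
lemma withDensity_walkDensity_apply {l m : ℝ} (hm : 0 < m) (k : ℕ) {s : Set ℝ}
    (hs : MeasurableSet s) :
    volume.withDensity (walkDensity l m k) {x : ℝ × ℝ | x.1 ∈ s ∧ x.1 ≤ x.2} =
      ∫⁻ t in s ∩ Ioi 0, ENNReal.ofReal (passageDensity l m k t) := by
  have hS : MeasurableSet {x : ℝ × ℝ | x.1 ∈ s ∧ x.1 ≤ x.2} :=
    (measurable_fst hs).inter (measurableSet_le measurable_fst measurable_snd)
  rw [withDensity_apply _ hS, ← lintegral_indicator hS, Measure.volume_eq_prod,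
    lintegral_prod _ ((measurable_walkDensity l m k).indicator hS).aemeasurable,
    ← lintegral_indicator (hs.inter measurableSet_Ioi)]
  congr 1 with a
  by_cases ha : a ∈ s ∩ Ioi 0
  · rw [indicator_of_mem ha]
    have ha0 : 0 < a := ha.2
    have : ∀ b, {x : ℝ × ℝ | x.1 ∈ s ∧ x.1 ≤ x.2}.indicator (walkDensity l m k) (a, b) =
        (Ici a).indicator (fun b => ENNReal.ofReal ((l * m) ^ (k + 1) * Real.exp (-(l * a)) *
          ballotPoly k a a) * ENNReal.ofReal (Real.exp (-(m * b)))) b := by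
      intro b
      by_cases hb : a ≤ b
      · rw [indicator_of_mem (show (a, b) ∈ {x : ℝ × ℝ | x.1 ∈ s ∧ x.1 ≤ x.2} from ⟨ha.1, hb⟩),
          indicator_of_mem (show b ∈ Ici a from hb), walkDensity,
          indicator_of_mem (show (a, b) ∈ {x : ℝ × ℝ | 0 < x.1 ∧ 0 < x.2} from
            ⟨ha0, ha0.trans_le hb⟩), ← ENNReal.ofReal_mul' (Real.exp_pos _).le]
        congr 1
        simp only [min_eq_left hb, neg_add, Real.exp_add]
        ring
      · rw [indicator_of_notMem (fun h => hb h.2), indicator_of_notMem (by exact hb)]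
    simp_rw [this]
    rw [lintegral_indicator measurableSet_Ici, lintegral_const_mul _ (by fun_prop),
      lintegral_Ici_exp hm, ← ENNReal.ofReal_mul' (by positivity), ballotPoly_diag, passageDensity]
    congr 1
    rw [neg_mul, add_mul, neg_add, Real.exp_add]
    ring
  · rw [indicator_of_notMem ha]
    refine lintegral_eq_zero_of_ae_eq_zero (ae_of_all _ fun b => ?_)
    by_contra hne
    change {x : ℝ × ℝ | x.1 ∈ s ∧ x.1 ≤ x.2}.indicator (walkDensity l m k) (a, b) ≠ 0 at hne
    have h1 := mem_of_indicator_ne_zero hne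
    rw [indicator_of_mem h1] at hne
    exact ha ⟨h1.1, (mem_of_indicator_ne_zero hne).1⟩

lemma summable_bessel (w : ℝ) : Summable fun k : ℕ => w ^ k / ((k ! : ℝ) * ((k + 1)! : ℝ)) := by
  refine Summable.of_norm_bounded (Real.summable_pow_div_factorial |w|) fun k => ?_
  rw [norm_div, norm_pow, Real.norm_eq_abs, Real.norm_of_nonneg (by positivity)]
  have : (1 : ℝ) ≤ ((k + 1)! : ℝ) := by exact_mod_cast Nat.one_le_iff_ne_zero.2 (Nat.factorial_ne_zero _)
  gcongr
  exact le_mul_of_one_le_right (by positivity) this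

lemma continuous_bessel :
    Continuous fun w : ℝ => ∑' k : ℕ, w ^ k / ((k ! : ℝ) * ((k + 1)! : ℝ)) := by
  refine continuous_iff_continuousAt.2 fun w => ?_
  have h : ContinuousOn (fun w : ℝ => ∑' k : ℕ, w ^ k / ((k ! : ℝ) * ((k + 1)! : ℝ)))
      (Metric.closedBall 0 (|w| + 1)) := by
    refine continuousOn_tsum (fun k => by fun_prop) (summable_bessel (|w| + 1)) fun k x hx => ?_
    rw [mem_closedBall_zero_iff] at hx
    rw [norm_div, norm_pow, Real.norm_of_nonneg (by positivity : 0 ≤ (k ! : ℝ) * ((k + 1)! : ℝ))]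
    gcongr
  refine h.continuousAt (Metric.closedBall_mem_nhds_of_mem ?_)
  simp

lemma hasSum_passageDensity {l m t : ℝ} (hl : 0 < l) (hm : 0 < m) (ht : 0 < t) :
    HasSum (fun k => passageDensity l m k t) (psiZero l m t) := by
  have h := (summable_bessel ((2 * t * Real.sqrt (l * m)) ^ 2 / 4)).hasSum.mul_left
    (l * Real.exp (-(l + m) * t))
  have hs : 0 < Real.sqrt (l * m) := Real.sqrt_pos.2 (by positivity)
  have hsq : Real.sqrt (l * m) ^ 2 = l * m := Real.sq_sqrt (by positivity)
  have h1 : (fun k => passageDensity l m k t) = fun k : ℕ => l * Real.exp (-(l + m) * t) *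
      (((2 * t * Real.sqrt (l * m)) ^ 2 / 4) ^ k / ((k ! : ℝ) * ((k + 1)! : ℝ))) := by
    ext k
    have : (2 * t * Real.sqrt (l * m)) ^ 2 / 4 = (l * m) * t ^ 2 := by
      rw [mul_pow, hsq]; ring
    rw [this, passageDensity, mul_pow (l * m), ← pow_mul, pow_succ]
    field_simp
  have h2 : psiZero l m t = l * Real.exp (-(l + m) * t) *
      ∑' k : ℕ, ((2 * t * Real.sqrt (l * m)) ^ 2 / 4) ^ k / ((k ! : ℝ) * ((k + 1)! : ℝ)) := by
    rw [psiZero, besselI]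
    field_simp
  rwa [h1, h2]

lemma psiZero_nonneg {l m t : ℝ} (hl : 0 < l) (hm : 0 < m) (ht : 0 < t) : 0 ≤ psiZero l m t :=
  (hasSum_passageDensity hl hm ht).nonneg fun k => by unfold passageDensity; positivity

lemma continuousOn_psiZero {l m : ℝ} (hl : 0 < l) (hm : 0 < m) :
    ContinuousOn (psiZero l m) (Ioi 0) := by
  unfold psiZero besselI
  refine ContinuousOn.mul (ContinuousOn.div (by fun_prop) (by fun_prop) fun t ht => ?_) ?_
  · have : 0 < Real.sqrt (l * m) := Real.sqrt_pos.2 (by positivity)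
    have ht : 0 < t := ht
    positivity
  · exact ((by fun_prop : Continuous fun t : ℝ => (2 * t * Real.sqrt (l * m) / 2) ^ 1).mul
      (continuous_bessel.comp
        (by fun_prop : Continuous fun t : ℝ => (2 * t * Real.sqrt (l * m)) ^ 2 / 4))).continuousOn

/-! ### Passage time and busy period path by path -/

section Paths

variable {Ω : Type*}

/-- The partial sums of `(U, D)`. -/
def walk (U D : ℕ → Ω → ℝ) (n : ℕ) (ω : Ω) : ℝ × ℝ :=
  (∑ i ∈ Finset.range n, U i ω, ∑ i ∈ Finset.range n, D i ω)

/-- The event that the sums of `D` stay below those of `U` before the index `n`. -/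
def staysBelow (U D : ℕ → Ω → ℝ) (n : ℕ) : Set Ω :=
  {ω | ∀ k, 1 ≤ k → k < n → (walk U D k ω).2 < (walk U D k ω).1}

/-- The event that the sums of `D` catch up with those of `U` at the index `k + 1` first. -/
def catchesUp (U D : ℕ → Ω → ℝ) (k : ℕ) : Set Ω :=
  {ω | (walk U D (k + 1) ω).1 ≤ (walk U D (k + 1) ω).2} ∩ staysBelow U D (k + 1)

variable {U D : ℕ → Ω → ℝ} {ω : Ω}

lemma pairwise_disjoint_catchesUp : Pairwise (Function.onFun Disjoint (catchesUp U D)) := by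
  have h : ∀ i j, i < j → Disjoint (catchesUp U D i) (catchesUp U D j) := by
    intro i j hij
    refine disjoint_left.2 fun ω hi hj => ?_
    exact (hj.2 (i + 1) (by omega) (by omega)).not_ge hi.1
  intro i j hij
  rcases lt_or_gt_of_ne hij with h1 | h1
  · exact h i j h1
  · exact (h j i h1).symm

lemma strictMono_sum_range {u : ℕ → ℝ} (hu : ∀ i, 0 < u i) :
    StrictMono fun n => ∑ i ∈ Finset.range n, u i :=
  strictMono_nat_of_lt_succ fun n => by
    rw [Finset.sum_range_succ]; exact lt_add_of_pos_right _ (hu n)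

lemma countN_eq (hU : ∀ i, 0 < U i ω) {t : ℝ} {k : ℕ} (h1 : ∑ i ∈ Finset.range k, U i ω ≤ t)
    (h2 : t < ∑ i ∈ Finset.range (k + 1), U i ω) : countN U t ω = k := by
  have : {n : ℕ | ∑ i ∈ Finset.range n, U i ω ≤ t} = Iic k := by
    ext n
    refine ⟨fun hn => ?_, fun hn => ?_⟩
    · exact Nat.lt_succ_iff.1 ((strictMono_sum_range hU).lt_iff_lt.1 (lt_of_le_of_lt hn h2))
    · exact ((strictMono_sum_range hU).monotone hn).trans h1
  rw [countN, this, csSup_Iic]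

lemma exists_renewal_interval
    (hlim : Filter.Tendsto (fun n => ∑ i ∈ Finset.range n, U i ω) Filter.atTop Filter.atTop)
    {t : ℝ} (ht : 0 < t) :
    ∃ k, ∑ i ∈ Finset.range k, U i ω ≤ t ∧ t < ∑ i ∈ Finset.range (k + 1), U i ω := by
  classical
  have hex : ∃ n, t < ∑ i ∈ Finset.range n, U i ω := (hlim.eventually_gt_atTop t).exists
  obtain ⟨k, hk⟩ : ∃ k, Nat.find hex = k + 1 := by
    refine Nat.exists_eq_succ_of_ne_zero fun h0 => ?_
    have := Nat.find_spec hex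
    rw [h0] at this
    simp at this
    exact this.not_gt ht
  refine ⟨k, not_lt.1 (Nat.find_min hex (by omega)), ?_⟩
  rw [← hk]
  exact Nat.find_spec hex

/-- On each renewal interval `Y(t) - t` is largest at the left end, so an early crossing at `t`
would force one at an earlier jump; before the first jump `Y = 0 < t`. -/
lemma passageTime_zero_eq (hU : ∀ i, 0 < U i ω)
    (hlim : Filter.Tendsto (fun n => ∑ i ∈ Finset.range n, U i ω) Filter.atTop Filter.atTop)
    {n : ℕ} (hn : 1 ≤ n)
    (hlt : ∀ k, 1 ≤ k → k < n → ∑ i ∈ Finset.range k, D i ω < ∑ i ∈ Finset.range k, U i ω)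
    (hle : ∑ i ∈ Finset.range n, U i ω ≤ ∑ i ∈ Finset.range n, D i ω) :
    passageTime U D 0 ω = ENNReal.ofReal (∑ i ∈ Finset.range n, U i ω) := by
  have hmono := strictMono_sum_range hU
  refine le_antisymm (sInf_le ⟨_, ⟨?_, ?_⟩, rfl⟩) (le_sInf ?_)
  · simpa using hmono (show 0 < n from hn)
  · rw [compoundY, countN_eq hU le_rfl (hmono (Nat.lt_succ_self n))]
    simpa using hle
  · rintro _ ⟨t, ⟨ht, hY⟩, rfl⟩
    refine ENNReal.ofReal_le_ofReal (not_lt.1 fun htn => ?_)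
    obtain ⟨k, hk1, hk2⟩ := exists_renewal_interval hlim ht
    rw [compoundY, countN_eq hU hk1 hk2, zero_add] at hY
    have hkn : k < n := hmono.lt_iff_lt.1 (hk1.trans_lt htn)
    rcases Nat.eq_zero_or_pos k with rfl | hk
    · simp at hY; exact hY.not_gt ht
    · linarith [hlt k hk hkn]

/-- Each of these customers arrives before the previous one leaves, so the server is never idle. -/
lemma departureTime_eq {n : ℕ}
    (hlt : ∀ k, 1 ≤ k → k < n → ∑ i ∈ Finset.range k, D i ω < ∑ i ∈ Finset.range k, U i ω) :
    ∀ k, k < n → departureTime U D k ω = ∑ i ∈ Finset.range (k + 1), U i ω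
  | 0, _ => by simp [departureTime, arrivalTime]
  | k + 1, hk => by
    rw [departureTime, departureTime_eq hlt k (by omega), arrivalTime,
      max_eq_right (hlt (k + 1) (by omega) hk).le, ← Finset.sum_range_succ]

/-- Strictness in `hle` matters: in case of equality customer `n` would arrive just as the others
have gone. At earlier times in the `k`-th renewal interval, customer `k` is present. -/
lemma busyPeriod_eq (hU : ∀ i, 0 < U i ω) (hD : ∀ i, 0 < D i ω)
    (hlim : Filter.Tendsto (fun n => ∑ i ∈ Finset.range n, U i ω) Filter.atTop Filter.atTop)
    {n : ℕ} (hn : 1 ≤ n)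
    (hlt : ∀ k, 1 ≤ k → k < n → ∑ i ∈ Finset.range k, D i ω < ∑ i ∈ Finset.range k, U i ω)
    (hle : ∑ i ∈ Finset.range n, U i ω < ∑ i ∈ Finset.range n, D i ω) :
    busyPeriod U D ω = ENNReal.ofReal (∑ i ∈ Finset.range n, U i ω) := by
  have hmono := strictMono_sum_range hU
  refine le_antisymm (sInf_le ⟨_, ⟨?_, ?_⟩, rfl⟩) (le_sInf ?_)
  · simpa using hmono (show 0 < n from hn)
  · rw [numberInSystem, encard_eq_zero, eq_empty_iff_forall_notMem]
    rintro j ⟨h1, h2⟩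
    rcases lt_or_ge j n with hj | hj
    · rw [departureTime_eq hlt j hj] at h2
      exact h2.not_ge (hmono.monotone hj)
    · exact (hle.trans_le ((strictMono_sum_range hD).monotone hj)).not_ge h1
  · rintro _ ⟨t, ⟨ht, h0⟩, rfl⟩
    refine ENNReal.ofReal_le_ofReal (not_lt.1 fun htn => ?_)
    obtain ⟨k, hk1, hk2⟩ := exists_renewal_interval hlim ht
    have hkn : k < n := hmono.lt_iff_lt.1 (hk1.trans_lt htn)
    rw [numberInSystem, encard_eq_zero, eq_empty_iff_forall_notMem] at h0
    refine h0 k ⟨?_, by rwa [departureTime_eq hlt k hkn]⟩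
    rcases Nat.eq_zero_or_pos k with rfl | hk
    · simpa [arrivalTime] using ht.le
    · exact (hlt k hk hkn).le.trans hk1

end Paths

/-! ### Exponential variables, strong law and independence -/

section Probability

variable {Ω : Type*} [MeasurableSpace Ω] {P : Measure Ω}

lemma ae_pos_of_hasLaw_expMeasure {X : Ω → ℝ} {r : ℝ} (hX : HasLaw X (expMeasure r) P) :
    ∀ᵐ ω ∂P, 0 < X ω := by
  have hm : Measurable fun x : ℝ => 0 < x := measurableSet_setOfPred.1 measurableSet_Ioi
  refine (hX.ae_iff hm).2 ?_
  have hd : expMeasure r = volume.withDensity (exponentialPDF r) := rfl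
  have hmeas : Measurable (exponentialPDF r) := (measurable_exponentialPDFReal r).ennreal_ofReal
  rw [hd, ae_withDensity_iff hmeas]
  filter_upwards [Measure.ae_ne volume (0 : ℝ)] with x hx h0
  by_contra hneg
  exact h0 (exponentialPDF_of_neg (lt_of_le_of_ne (not_lt.1 hneg) hx))

lemma integrable_and_integral_of_hasLaw_expMeasure {X : Ω → ℝ} {r : ℝ} (hr : 0 < r)
    (hX : HasLaw X (expMeasure r) P) : Integrable X P ∧ ∫ ω, X ω ∂P = 1 / r := by
  have hd : expMeasure r = volume.withDensity (exponentialPDF r) := rfl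
  have hmeas : Measurable (exponentialPDF r) := (measurable_exponentialPDFReal r).ennreal_ofReal
  have hfin : ∀ᵐ x : ℝ, exponentialPDF r x < ∞ := ae_of_all _ fun x => ENNReal.ofReal_lt_top
  have hG : ∫ x in Ioi (0 : ℝ), x ^ ((2 : ℝ) - 1) * Real.exp (-(r * x)) = (1 / r) ^ (2 : ℝ) := by
    rw [Real.integral_rpow_mul_exp_neg_mul_Ioi two_pos hr, Real.Gamma_two, mul_one]
  have hI : ∫ x in Ioi (0 : ℝ), r * (x ^ ((2 : ℝ) - 1) * Real.exp (-(r * x))) = 1 / r := by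
    rw [integral_const_mul, hG, Real.rpow_two]
    field_simp
  have hi : IntegrableOn (fun x => r * (x ^ ((2 : ℝ) - 1) * Real.exp (-(r * x)))) (Ioi 0) := by
    -- The Bochner integral of a non-integrable function is `0`, so the Gamma value already proves
    -- integrability.
    refine Integrable.of_integral_ne_zero ?_
    rw [hI]; positivity
  have hfun : (fun x => (exponentialPDF r x).toReal • x) = (Ioi (0 : ℝ)).indicator
      (fun x => r * (x ^ ((2 : ℝ) - 1) * Real.exp (-(r * x)))) := by
    ext x
    rcases lt_trichotomy x 0 with hx | rfl | hx
    · rw [exponentialPDF_of_neg hx, indicator_of_notMem (by simpa using hx.le)]; simp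
    · simp
    · rw [exponentialPDF_of_nonneg hx.le, indicator_of_mem (by exact hx),
        ENNReal.toReal_ofReal (by positivity)]
      norm_num
      ring
  have hint : Integrable (fun x : ℝ => x) (expMeasure r) := by
    rw [hd, integrable_withDensity_iff_integrable_smul' hmeas hfin, hfun,
      integrable_indicator_iff measurableSet_Ioi]
    exact hi
  refine ⟨?_, ?_⟩
  · have := hint
    rw [← hX.map_eq] at this
    exact (integrable_map_measure aestronglyMeasurable_id hX.aemeasurable).1 this
  · rw [hX.integral_eq, hd, integral_withDensity_eq_integral_toReal_smul hmeas hfin, hfun,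
      integral_indicator measurableSet_Ioi, hI]

lemma ae_tendsto_average_of_hasLaw_expMeasure {X : ℕ → Ω → ℝ} {r : ℝ} (hr : 0 < r)
    (hX : ∀ n, HasLaw (X n) (expMeasure r) P) (hind : iIndepFun X P) :
    ∀ᵐ ω ∂P, Filter.Tendsto (fun n : ℕ => (∑ i ∈ Finset.range n, X i ω) / n) Filter.atTop
      (nhds (1 / r)) := by
  obtain ⟨h1, h2⟩ := integrable_and_integral_of_hasLaw_expMeasure hr (hX 0)
  rw [← h2]
  exact strong_law_ae_real X h1 (fun i j hij => hind.indepFun hij)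
    fun i => (hX i).identDistrib (hX 0)

lemma tendsto_atTop_of_tendsto_div {s : ℕ → ℝ} {c : ℝ} (hc : 0 < c)
    (h : Filter.Tendsto (fun n : ℕ => s n / n) Filter.atTop (nhds c)) :
    Filter.Tendsto s Filter.atTop Filter.atTop := by
  refine (h.pos_mul_atTop hc tendsto_natCast_atTop_atTop).congr' ?_
  filter_upwards [Filter.eventually_gt_atTop 0] with n hn
  field_simp

/-- Lets the two sequences be merged into one independent family indexed by `Bool × ℕ`. -/
lemma iIndepFun_bool {β : Bool → Type*} [∀ b, MeasurableSpace (β b)] [IsProbabilityMeasure P]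
    {f : (b : Bool) → Ω → β b} (h : IndepFun (f true) (f false) P) : iIndepFun f P := by
  rw [iIndepFun_iff_measure_inter_preimage_eq_mul]
  intro S sets hS
  have h2 : S = ∅ ∨ S = {true} ∨ S = {false} ∨ S = {true, false} := by
    clear hS
    revert S; decide
  rcases h2 with rfl | rfl | rfl | rfl
  · simp
  · simp
  · simp
  · have := (indepFun_iff_measure_inter_preimage_eq_mul.1 h) (sets true) (sets false)
      (hS _ (by simp)) (hS _ (by simp))
    rw [Finset.set_biInter_insert, Finset.set_biInter_singleton, this]
    simp

variable {U D : ℕ → Ω → ℝ}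

lemma measurable_walk (hU : ∀ n, Measurable (U n)) (hD : ∀ n, Measurable (D n)) (n : ℕ) :
    Measurable (walk U D n) := by
  unfold walk; fun_prop

lemma measurableSet_staysBelow (hU : ∀ n, Measurable (U n)) (hD : ∀ n, Measurable (D n)) (n : ℕ) :
    MeasurableSet (staysBelow U D n) := by
  unfold staysBelow
  simp only [ofPred_forall]
  exact MeasurableSet.iInter fun k => MeasurableSet.iInter fun _ => MeasurableSet.iInter fun _ =>
    measurableSet_lt (measurable_walk hU hD k).snd (measurable_walk hU hD k).fst

/-- The path frozen at index `n` encodes the whole past as a function of the pairs with index below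
`n`. -/
lemma indepFun_walk [IsProbabilityMeasure P]
    (hU : ∀ n, Measurable (U n)) (hD : ∀ n, Measurable (D n))
    (hUindep : iIndepFun U P) (hDindep : iIndepFun D P)
    (hUD : IndepFun (fun ω n => U n ω) (fun ω n => D n ω) P) (n : ℕ) :
    IndepFun (fun ω (k : ℕ) => walk U D (min k n) ω) (fun ω => (U n ω, D n ω)) P := by
  let X : Bool → ℕ → Ω → ℝ := fun b => if b then U else D
  have hX : ∀ b i, Measurable (X b i) := by
    rintro (_ | _) i
    · exact hD i
    · exact hU i
  have h1 : iIndepFun (fun p : Bool × ℕ => X p.1 p.2) P := by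
    refine iIndepFun_uncurry' hX (iIndepFun_bool hUD) ?_
    rintro (_ | _)
    · exact hDindep
    · exact hUindep
  have h2 := h1.indepFun_finset (Finset.univ ×ˢ Finset.range n) (Finset.univ ×ˢ {n})
    (Finset.disjoint_left.2 fun p hp hq => by
      simp at hp hq; rcases hq with rfl | rfl <;> simp at hp) (fun p => hX p.1 p.2)
  -- Extension by zero of the finite vector of past increments, so that sums can run over plain
  -- ranges.
  let g : ((Finset.univ ×ˢ Finset.range n : Finset (Bool × ℕ)) → ℝ) → Bool → ℕ → ℝ :=
    fun v b i => if h : (b, i) ∈ (Finset.univ ×ˢ Finset.range n : Finset (Bool × ℕ))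
      then v ⟨(b, i), h⟩ else 0
  have hg : ∀ b i, Measurable fun v => g v b i := by
    intro b i
    by_cases h : (b, i) ∈ (Finset.univ ×ˢ Finset.range n : Finset (Bool × ℕ))
    · simp only [g, h, dite_true]; fun_prop
    · simp only [g, h, dite_false]; fun_prop
  have hgX : ∀ b i, i < n → ∀ ω, g (fun p => X p.1.1 p.1.2 ω) b i = X b i ω := by
    intro b i hi ω
    have : (b, i) ∈ (Finset.univ ×ˢ Finset.range n : Finset (Bool × ℕ)) := by simpa using hi
    simp only [g, this, dite_true]
  have hφ : Measurable fun v (k : ℕ) => (∑ i ∈ Finset.range (min k n), g v true i,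
      ∑ i ∈ Finset.range (min k n), g v false i) := by fun_prop
  have hψ : Measurable fun v : ((Finset.univ ×ˢ {n} : Finset (Bool × ℕ)) → ℝ) =>
      (v ⟨(true, n), by simp⟩, v ⟨(false, n), by simp⟩) := by fun_prop
  have h3 := h2.comp hφ hψ
  convert h3 using 1
  ext ω k
  · simp only [walk, Function.comp_apply]
    refine Finset.sum_congr rfl fun i hi => ?_
    rw [hgX _ _ (by simp at hi; omega)]; rfl
  · simp only [walk, Function.comp_apply]
    refine Finset.sum_congr rfl fun i hi => ?_
    rw [hgX _ _ (by simp at hi; omega)]; rfl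
  · rfl

/-! ### Law of the walk restricted to not having caught up -/

/-- Adding an independent increment on an event of the past convolves the restricted law. -/
lemma map_add_restrict_eq_conv [IsFiniteMeasure P] {𝓥 E : Type*} [MeasurableSpace 𝓥]
    [MeasurableSpace E] [AddMonoid E] [MeasurableAdd₂ E] {V : Ω → 𝓥} {Y : Ω → E}
    (hV : Measurable V) (hY : Measurable Y) (h : IndepFun V Y P) {f : 𝓥 → E} (hf : Measurable f)
    {C : Set 𝓥} (hC : MeasurableSet C) :
    (P.restrict (V ⁻¹' C)).map (fun ω => f (V ω) + Y ω) =
      ((P.restrict (V ⁻¹' C)).map fun ω => f (V ω)).conv (P.map Y) := by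
  have hprod := h.map_prod_eq_prod_map_map hV.aemeasurable hY.aemeasurable
  have e1 : (P.restrict (V ⁻¹' C)).map (fun ω => f (V ω)) = ((P.map V).restrict C).map f := by
    rw [Measure.restrict_map hV hC, Measure.map_map hf hV]; rfl
  have e2 : ((P.map V).restrict C).prod (P.map Y) =
      (P.restrict (V ⁻¹' C)).map fun ω => (V ω, Y ω) := by
    have : (fun ω => (V ω, Y ω)) ⁻¹' (C ×ˢ univ) = V ⁻¹' C := by ext; simp
    rw [← this, ← Measure.restrict_map (hV.prodMk hY) (hC.prod MeasurableSet.univ), hprod,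
      ← Measure.prod_restrict, Measure.restrict_univ]
  have e3 : (((P.map V).restrict C).map f).prod (P.map Y) =
      (((P.map V).restrict C).prod (P.map Y)).map (Prod.map f id) := by
    rw [← Measure.map_prod_map _ _ hf measurable_id, Measure.map_id]
  rw [e1, Measure.conv, e3, e2, Measure.map_map (hf.prodMap measurable_id) (hV.prodMk hY),
    Measure.map_map (by fun_prop) ((hf.prodMap measurable_id).comp (hV.prodMk hY))]
  rfl

/-- Induction on `k`: staying below at one more index multiplies the density by an indicator, and
the next increment, independent of that event, convolves it with the one-step density. -/
lemma map_walk_restrict_staysBelow [IsProbabilityMeasure P] {l m : ℝ} (hl : 0 < l) (hm : 0 < m)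
    (hU : ∀ n, Measurable (U n)) (hD : ∀ n, Measurable (D n))
    (hUl : ∀ n, HasLaw (U n) (expMeasure l) P) (hDl : ∀ n, HasLaw (D n) (expMeasure m) P)
    (hUindep : iIndepFun U P) (hDindep : iIndepFun D P)
    (hUD : IndepFun (fun ω n => U n ω) (fun ω n => D n ω) P) (k : ℕ) :
    (P.restrict (staysBelow U D (k + 1))).map (walk U D (k + 1)) =
      volume.withDensity (walkDensity l m k) := by
  have hpair : ∀ n, P.map (fun ω => (U n ω, D n ω)) = volume.withDensity (walkDensity l m 0) := by
    intro n
    have h : IndepFun (U n) (D n) P :=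
      hUD.comp (measurable_pi_apply n) (measurable_pi_apply n)
    rw [h.map_prod_eq_prod_map_map (hU n).aemeasurable (hD n).aemeasurable, (hUl n).map_eq,
      (hDl n).map_eq, expMeasure_prod_expMeasure hl]
  induction k with
  | zero =>
    have h1 : staysBelow U D (0 + 1) = univ := eq_univ_of_forall fun ω j h1 h2 => by omega
    rw [h1, Measure.restrict_univ, ← hpair 0]
    congr 1
    ext ω <;> simp [walk]
  | succ k ih =>
    have hG : MeasurableSet {x : ℝ × ℝ | x.2 < x.1} := measurableSet_lt measurable_snd measurable_fst
    let C : Set (ℕ → ℝ × ℝ) := {v | ∀ j, 1 ≤ j → j < k + 1 + 1 → (v j).2 < (v j).1}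
    have hC : MeasurableSet C := by
      simp only [C, ofPred_forall]
      exact MeasurableSet.iInter fun j => MeasurableSet.iInter fun _ => MeasurableSet.iInter fun _ =>
        measurableSet_lt (measurable_pi_apply j).snd (measurable_pi_apply j).fst
    have hpre : (fun ω (j : ℕ) => walk U D (min j (k + 1)) ω) ⁻¹' C = staysBelow U D (k + 1 + 1) := by
      ext ω
      refine forall_congr' fun j => forall_congr' fun _ => forall_congr' fun hj => ?_
      simp only [min_eq_left (show j ≤ k + 1 by omega)]
    have h1 := map_add_restrict_eq_conv (P := P)
      (measurable_pi_lambda _ fun j => measurable_walk hU hD (min j (k + 1)))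
      ((hU (k + 1)).prodMk (hD (k + 1))) (indepFun_walk hU hD hUindep hDindep hUD (k + 1))
      (measurable_pi_apply (k + 1)) hC
    rw [hpre, hpair] at h1
    simp only [min_self] at h1
    have h2 : staysBelow U D (k + 1 + 1) =
        (walk U D (k + 1)) ⁻¹' {x : ℝ × ℝ | x.2 < x.1} ∩ staysBelow U D (k + 1) := by
      ext ω
      refine ⟨fun h => ⟨h (k + 1) (by omega) (by omega), fun j h1 h2 => h j h1 (by omega)⟩, ?_⟩
      rintro ⟨h, h'⟩ j h1 h2
      rcases Nat.lt_succ_iff_lt_or_eq.1 h2 with h3 | rfl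
      · exact h' j h1 h3
      · exact h
    have h3 : (P.restrict (staysBelow U D (k + 1 + 1))).map (fun ω => walk U D (k + 1) ω) =
        volume.withDensity ({x : ℝ × ℝ | x.2 < x.1}.indicator (walkDensity l m k)) := by
      rw [h2, ← Measure.restrict_restrict (measurable_walk hU hD _ hG),
        ← Measure.restrict_map (measurable_walk hU hD _) hG, ih, withDensity_indicator hG,
        restrict_withDensity hG]
    rw [h3, conv_withDensity_eq_lconvolution
      ((measurable_walkDensity l m k).indicator hG) (measurable_walkDensity l m 0),
      walkDensity_lconvolution hl hm] at h1
    rw [← h1]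
    congr 1
    ext ω <;> simp [walk, Finset.sum_range_succ]

lemma measurableSet_catchesUp (hU : ∀ n, Measurable (U n)) (hD : ∀ n, Measurable (D n)) (k : ℕ) :
    MeasurableSet (catchesUp U D k) :=
  (measurableSet_le (measurable_walk hU hD _).fst (measurable_walk hU hD _).snd).inter
    (measurableSet_staysBelow hU hD _)

lemma map_fst_walk_restrict_catchesUp [IsProbabilityMeasure P] {l m : ℝ} (hl : 0 < l) (hm : 0 < m)
    (hU : ∀ n, Measurable (U n)) (hD : ∀ n, Measurable (D n))
    (hUl : ∀ n, HasLaw (U n) (expMeasure l) P) (hDl : ∀ n, HasLaw (D n) (expMeasure m) P)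
    (hUindep : iIndepFun U P) (hDindep : iIndepFun D P)
    (hUD : IndepFun (fun ω n => U n ω) (fun ω n => D n ω) P) (k : ℕ) :
    (P.restrict (catchesUp U D k)).map (fun ω => (walk U D (k + 1) ω).1) =
      (volume.restrict (Ioi (0 : ℝ))).withDensity
        (fun t => ENNReal.ofReal (passageDensity l m k t)) := by
  ext s hs
  have hw := measurable_walk hU hD (k + 1)
  have hS : MeasurableSet {x : ℝ × ℝ | x.1 ∈ s ∧ x.1 ≤ x.2} :=
    (measurable_fst hs).inter (measurableSet_le measurable_fst measurable_snd)
  rw [withDensity_apply _ hs, Measure.restrict_restrict hs, ← withDensity_walkDensity_apply hm k hs,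
    ← map_walk_restrict_staysBelow hl hm hU hD hUl hDl hUindep hDindep hUD k,
    Measure.map_apply hw hS, Measure.restrict_apply (hw hS), Measure.map_apply hw.fst hs,
    Measure.restrict_apply (hw.fst hs)]
  congr 1
  ext ω
  simp only [catchesUp, mem_inter_iff, mem_preimage, mem_ofPred_eq]
  tauto

/-- The averages tend to `1/l < 1/m`, so the `D`-sums eventually exceed the `U`-sums; take the first
index of catching up. -/
lemma ae_exists_mem_catchesUp {l m : ℝ} (hm : 0 < m) (hml : m < l)
    (hUl : ∀ n, HasLaw (U n) (expMeasure l) P) (hDl : ∀ n, HasLaw (D n) (expMeasure m) P)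
    (hUindep : iIndepFun U P) (hDindep : iIndepFun D P) :
    ∀ᵐ ω ∂P, ∃ k, ω ∈ catchesUp U D k := by
  classical
  filter_upwards [ae_tendsto_average_of_hasLaw_expMeasure (hm.trans hml) hUl hUindep,
    ae_tendsto_average_of_hasLaw_expMeasure hm hDl hDindep] with ω h1 h2
  have hex : ∃ k, (walk U D (k + 1) ω).1 ≤ (walk U D (k + 1) ω).2 := by
    have h3 := (h1.eventually_lt h2 (one_div_lt_one_div_of_lt hm hml)).and
      (Filter.eventually_gt_atTop 0)
    obtain ⟨n, hn, hn0⟩ := h3.exists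
    obtain ⟨k, rfl⟩ := Nat.exists_eq_succ_of_ne_zero hn0.ne'
    exact ⟨k, ((div_lt_div_iff_of_pos_right (by exact_mod_cast hn0)).1 hn).le⟩
  refine ⟨Nat.find hex, Nat.find_spec hex, fun j hj1 hj2 => ?_⟩
  obtain ⟨i, rfl⟩ := Nat.exists_eq_succ_of_ne_zero (Nat.one_le_iff_ne_zero.1 hj1)
  exact not_le.1 (Nat.find_min hex (m := i) (by omega))

/-- The restricted law of the walk has a density, so it does not charge the diagonal. -/
lemma ae_catchesUp_imp_lt [IsProbabilityMeasure P] {l m : ℝ} (hl : 0 < l) (hm : 0 < m)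
    (hU : ∀ n, Measurable (U n)) (hD : ∀ n, Measurable (D n))
    (hUl : ∀ n, HasLaw (U n) (expMeasure l) P) (hDl : ∀ n, HasLaw (D n) (expMeasure m) P)
    (hUindep : iIndepFun U P) (hDindep : iIndepFun D P)
    (hUD : IndepFun (fun ω n => U n ω) (fun ω n => D n ω) P) (k : ℕ) :
    ∀ᵐ ω ∂P, ω ∈ catchesUp U D k → (walk U D (k + 1) ω).1 < (walk U D (k + 1) ω).2 := by
  have hne : ∀ᵐ x : ℝ × ℝ, x.1 ≠ x.2 := by
    rw [Measure.volume_eq_prod, Measure.ae_prod_iff_ae_ae (p := fun x : ℝ × ℝ => x.1 ≠ x.2)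
      (measurableSet_eq_fun measurable_fst measurable_snd).compl]
    exact ae_of_all _ fun a => (Measure.ae_ne volume a).mono fun b hb => hb.symm
  have h1 := (withDensity_absolutelyContinuous volume (walkDensity l m k)).ae_le hne
  rw [← map_walk_restrict_staysBelow hl hm hU hD hUl hDl hUindep hDindep hUD k] at h1
  have h2 := (ae_restrict_iff' (measurableSet_staysBelow hU hD _)).1
    (ae_of_ae_map (measurable_walk hU hD _).aemeasurable h1)
  filter_upwards [h2] with ω h hω
  exact lt_of_le_of_ne hω.1 (h hω.2)

/-! ### From the pieces to the law and its derivative -/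

/-- The law of a map that is given by `g k` on the `k`-th piece of a countable partition. -/
lemma hasLaw_sum_of_partition {𝓧 : Type*} [MeasurableSpace 𝓧] {E : ℕ → Set Ω}
    (hE : ∀ k, MeasurableSet (E k)) (hdisj : Pairwise (Function.onFun Disjoint E))
    (hcover : ∀ᵐ ω ∂P, ∃ k, ω ∈ E k) {T : Ω → 𝓧} {g : ℕ → Ω → 𝓧} (hg : ∀ k, Measurable (g k))
    (hT : ∀ k, ∀ᵐ ω ∂P, ω ∈ E k → T ω = g k ω) :
    HasLaw T (Measure.sum fun k => (P.restrict (E k)).map (g k)) P := by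
  have hP : P = Measure.sum fun k => P.restrict (E k) := by
    rw [← Measure.restrict_iUnion hdisj hE, Measure.restrict_eq_self_of_ae_mem]
    simpa only [mem_iUnion] using hcover
  have hTk : ∀ k, T =ᵐ[P.restrict (E k)] g k := fun k => (ae_restrict_iff' (hE k)).2 (hT k)
  have hTm : AEMeasurable T (Measure.sum fun k => P.restrict (E k)) :=
    aemeasurable_sum_measure_iff.2 fun k => (hg k).aemeasurable.congr (hTk k).symm
  refine ⟨by rw [hP]; exact hTm, ?_⟩
  conv_lhs => rw [hP]
  rw [Measure.map_sum hTm]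
  congr 1
  ext1 k
  exact Measure.map_congr (hTk k)

lemma hasDensity_of_hasLaw [IsProbabilityMeasure P] {T : Ω → ℝ≥0∞} {f : ℝ → ℝ}
    (hf : ContinuousOn f (Ioi 0)) (h0 : ∀ t, 0 < t → 0 ≤ f t)
    (hT : HasLaw T (((volume.restrict (Ioi (0 : ℝ))).withDensity
      (fun t => ENNReal.ofReal (f t))).map ENNReal.ofReal) P) :
    HasDensity P T f := by
  refine ⟨h0, hT, fun t ht => ?_⟩
  have hmeas : AEStronglyMeasurable f (volume.restrict (Ioi 0)) :=
    hf.aestronglyMeasurable measurableSet_Ioi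
  have hnn : 0 ≤ᵐ[volume.restrict (Ioi (0 : ℝ))] f :=
    (ae_restrict_iff' measurableSet_Ioi).2 (ae_of_all _ h0)
  -- The law of `T` is a probability measure, which gives the mass of `f` and hence its
  -- integrability.
  have hmass : ∫⁻ t in Ioi 0, ENNReal.ofReal (f t) = 1 := by
    have h1 := hT.isProbabilityMeasure_iff.1 ‹_›
    have h2 := h1.measure_univ
    rwa [Measure.map_apply ENNReal.measurable_ofReal MeasurableSet.univ, preimage_univ,
      withDensity_apply _ MeasurableSet.univ, Measure.restrict_univ] at h2
  have hint : IntegrableOn f (Ioi 0) := by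
    refine ⟨hmeas, ?_⟩
    rw [hasFiniteIntegral_iff_ofReal hnn, hmass]
    exact ENNReal.one_lt_top
  have hcdf : ∀ s : ℝ, 0 < s → P.real {ω | T ω ≤ ENNReal.ofReal s} = ∫ x in (0 : ℝ)..s, f x := by
    intro s hs
    have hpre : ENNReal.ofReal ⁻¹' {x | x ≤ ENNReal.ofReal s} = Iic s := by
      ext x; simp [ENNReal.ofReal_le_ofReal_iff hs.le]
    have hmeasI : MeasurableSet {x | x ≤ ENNReal.ofReal s} := measurableSet_Iic
    rw [hT.measureReal_eq hmeasI, measureReal_def,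
      Measure.map_apply ENNReal.measurable_ofReal hmeasI, hpre,
      withDensity_apply _ measurableSet_Iic, Measure.restrict_restrict measurableSet_Iic, inter_comm,
      Ioi_inter_Iic, intervalIntegral.integral_of_le hs.le,
      integral_eq_lintegral_of_nonneg_ae
        (ae_restrict_of_ae_restrict_of_subset Ioc_subset_Ioi_self hnn)
        (hmeas.mono_set Ioc_subset_Ioi_self)]
  have hF : HasDerivAt (fun s => ∫ x in (0 : ℝ)..s, f x) (f t) t := by
    refine intervalIntegral.integral_hasDerivAt_right ?_ ?_ (hf.continuousAt (Ioi_mem_nhds ht))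
    · exact (intervalIntegrable_iff_integrableOn_Ioc_of_le ht.le).2
        (hint.mono_set Ioc_subset_Ioi_self)
    · exact hf.stronglyMeasurableAtFilter isOpen_Ioi t ht
  refine hF.congr_of_eventuallyEq ?_
  filter_upwards [Ioi_mem_nhds ht] with s hs
  exact hcdf s hs

/-- Stated for any `T` that equals the `U`-sum at the catching-up index almost surely, to serve both
the passage time and the busy period. -/
lemma hasDensity_psiZero [IsProbabilityMeasure P] {l m : ℝ} (hm : 0 < m) (hml : m < l)
    (hU : ∀ n, Measurable (U n)) (hD : ∀ n, Measurable (D n))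
    (hUl : ∀ n, HasLaw (U n) (expMeasure l) P) (hDl : ∀ n, HasLaw (D n) (expMeasure m) P)
    (hUindep : iIndepFun U P) (hDindep : iIndepFun D P)
    (hUD : IndepFun (fun ω n => U n ω) (fun ω n => D n ω) P) {T : Ω → ℝ≥0∞}
    (hT : ∀ k, ∀ᵐ ω ∂P, ω ∈ catchesUp U D k → T ω = ENNReal.ofReal (walk U D (k + 1) ω).1) :
    HasDensity P T (psiZero l m) := by
  have hl := hm.trans hml
  refine hasDensity_of_hasLaw (continuousOn_psiZero hl hm) (fun t => psiZero_nonneg hl hm) ?_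
  have h := hasLaw_sum_of_partition (measurableSet_catchesUp hU hD) pairwise_disjoint_catchesUp
    (ae_exists_mem_catchesUp hm hml hUl hDl hUindep hDindep)
    (fun k => (measurable_walk hU hD (k + 1)).fst.ennreal_ofReal) hT
  convert h using 1
  have h1 : ∀ k, (P.restrict (catchesUp U D k)).map
      (fun ω => ENNReal.ofReal (walk U D (k + 1) ω).1) =
      ((volume.restrict (Ioi (0 : ℝ))).withDensity
        (fun t => ENNReal.ofReal (passageDensity l m k t))).map ENNReal.ofReal := by
    intro k
    rw [← map_fst_walk_restrict_catchesUp hl hm hU hD hUl hDl hUindep hDindep hUD k,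
      Measure.map_map ENNReal.measurable_ofReal (measurable_walk hU hD (k + 1)).fst]
    rfl
  simp_rw [h1]
  rw [← Measure.map_sum ENNReal.measurable_ofReal.aemeasurable, ← withDensity_tsum]
  · congr 1
    refine withDensity_congr_ae ((ae_restrict_iff' measurableSet_Ioi).2 (ae_of_all _ fun t ht => ?_))
    have hs := hasSum_passageDensity hl hm (show 0 < t from ht)
    simp only [ENNReal.tsum_apply]
    rw [← hs.tsum_eq, ENNReal.ofReal_tsum_of_nonneg _ hs.summable]
    intro k
    unfold passageDensity
    have : 0 < t := ht
    positivity
  · intro k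
    unfold passageDensity
    fun_prop

end Probability

end Telegraph

theorem mainTheorem2 {Ω : Type*} [MeasurableSpace Ω] (P : Measure Ω) [IsProbabilityMeasure P]
    (l m : ℝ) (hm : 0 < m) (hml : m < l)
    (U D : ℕ → Ω → ℝ)
    (hU : ∀ n, HasLaw (U n) (expMeasure l) P)
    (hD : ∀ n, HasLaw (D n) (expMeasure m) P)
    (hUindep : iIndepFun U P) (hDindep : iIndepFun D P)
    (hUD : IndepFun (fun ω n => U n ω) (fun ω n => D n ω) P) :
    Telegraph.HasDensity P (Telegraph.passageTime U D 0) (Telegraph.psiZero l m) ∧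
      Telegraph.HasDensity P (Telegraph.busyPeriod U D) (Telegraph.psiZero l m) := by
  have hl := hm.trans hml
  -- `HasLaw` gives only a.e. measurability; measurable versions carry the law computations, and
  -- agree with `U` and `D` almost surely at all indices.
  let U' : ℕ → Ω → ℝ := fun n => (hU n).aemeasurable.mk (U n)
  let D' : ℕ → Ω → ℝ := fun n => (hD n).aemeasurable.mk (D n)
  have hUm : ∀ n, Measurable (U' n) := fun n => (hU n).aemeasurable.measurable_mk
  have hDm : ∀ n, Measurable (D' n) := fun n => (hD n).aemeasurable.measurable_mk
  have hUU : ∀ n, U n =ᵐ[P] U' n := fun n => (hU n).aemeasurable.ae_eq_mk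
  have hDD : ∀ n, D n =ᵐ[P] D' n := fun n => (hD n).aemeasurable.ae_eq_mk
  have hU' : ∀ n, HasLaw (U' n) (expMeasure l) P := fun n => (hU n).congr (hUU n).symm
  have hD' : ∀ n, HasLaw (D' n) (expMeasure m) P := fun n => (hD n).congr (hDD n).symm
  have hUi : iIndepFun U' P := hUindep.congr hUU
  have hDi : iIndepFun D' P := hDindep.congr hDD
  have hUD' : IndepFun (fun ω n => U' n ω) (fun ω n => D' n ω) P :=
    hUD.congr ((ae_all_iff.2 hUU).mono fun ω h => funext h)
      ((ae_all_iff.2 hDD).mono fun ω h => funext h)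
  have hlim := (Telegraph.ae_tendsto_average_of_hasLaw_expMeasure hl hU hUindep).mono
    fun ω h => Telegraph.tendsto_atTop_of_tendsto_div (one_div_pos.2 hl) h
  have hUpos := ae_all_iff.2 fun n => Telegraph.ae_pos_of_hasLaw_expMeasure (hU n)
  have hDpos := ae_all_iff.2 fun n => Telegraph.ae_pos_of_hasLaw_expMeasure (hD n)
  constructor
  · refine Telegraph.hasDensity_psiZero hm hml hUm hDm hU' hD' hUi hDi hUD' fun k => ?_
    filter_upwards [hlim, hUpos, ae_all_iff.2 hUU, ae_all_iff.2 hDD] with ω h1 h2 h3 h4 hω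
    simp only [Telegraph.catchesUp, Telegraph.staysBelow, Telegraph.walk, mem_inter_iff, mem_ofPred_eq,
      ← h3, ← h4] at hω ⊢
    exact Telegraph.passageTime_zero_eq h2 h1 (by omega) hω.2 hω.1
  · refine Telegraph.hasDensity_psiZero hm hml hUm hDm hU' hD' hUi hDi hUD' fun k => ?_
    filter_upwards [hlim, hUpos, hDpos, ae_all_iff.2 hUU, ae_all_iff.2 hDD,
      Telegraph.ae_catchesUp_imp_lt hl hm hUm hDm hU' hD' hUi hDi hUD' k] with ω h1 h2 h5 h3 h4 h6 hω
    have h7 := h6 hω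
    have h8 := hω.2
    simp only [Telegraph.staysBelow, Telegraph.walk, mem_ofPred_eq, ← h3, ← h4] at h7 h8 ⊢
    exact Telegraph.busyPeriod_eq h2 h5 h1 (by omega) h8 h7
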